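/- Let $R$ be a complete discrete valuation ring with maximal ideal $\mathfrak p\nmid 2$ (i.e. $2\in R^\times$), valuation $v$ and fraction field $K$. Let $B$ be a quaternion algebra over $K$ (central simple of dimension $4$), with natural involution $x\mapsto\bar x$ and reduced trace $\operatorname{Tr}(x)=x+\bar x$. Let $a,b\in R$ be nonzero, and let $\mathcal O\subseteq B$ be an $R$-order in correspondence with the ternary quadratic form $f=\langle 1,a,b\rangle$, i.e. isomorphic as an $R$-algebra to the even Clifford algebra $C_0(f)$. A basis $\{1,e_1,e_2,e_3\}$ of the $R$-module $\mathcal O$ is called *good* if $$e_1^2=-ab,\quad e_2^2=-b,\quad e_3^2=-a,$$ $$e_1e_2=-be_3=-e_2e_1,\quad e_2e_3=-e_1=-e_3e_2,\quad e_3e_1=-ae_2=-e_1e_3,$$ and *quasi-good* if there is a good basis $\{1,\tilde e_1,\tilde e_2,\tilde e_3\}$ of $\mathcal O$ with $\tilde e_i\equiv e_i \pmod{\mathfrak p\mathcal O}$ for $1\le i\le 3$. Let $\mathcal E=\{f_0,f_1,f_2,f_3\}$ be a basis of the dual lattice $\mathcal O^\vee=\{x\in B:\operatorname{Tr}(x\mathcal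 O)\subseteq R\}$ with $\operatorname{Tr}(f_0)=1$ and $\operatorname{Tr}(f_1)=\operatorname{Tr}(f_2)=\operatorname{Tr}(f_3)=0$. Put $M_{\mathcal E}=(\operatorname{Tr}(f_i\bar f_j))_{1\le i,j\le 3}$, and $\mathcal E^\dagger=\{1,e_1,e_2,e_3\}$, where $e_i=4ab\,f_j\bar f_k$ for $(i,j,k)$ an even permutation of $(1,2,3)$. Let $n=2v(a)+1$, and assume: (a) there exists $\tilde b\in R$ such that $2ab\,M_{\mathcal E}\equiv\operatorname{diag}(1,a,\tilde b)$ modulo $M_3(\mathfrak p^n)$; (b) $\det M_{\mathcal E}=8^{-1}(ab)^{-2}u^2$ for some $u\in R$ with $u^2\equiv 1\pmod{\mathfrak p}$ (for instance $u=1$). Then $\mathcal E^\dagger$ is a quasi-good basis of $\mathcal O$. -/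

import Mathlib

noncomputable section

namespace QuatOrder

section Algebra

variable (K : Type*) {B : Type*} [Field K] [Ring B] [Algebra K B]

/-- The reduced trace of a quaternion algebra over a field of characteristic different from `2`:
half of the trace of left multiplication (the regular trace of a central simple algebra of
dimension `m ^ 2` is `m` times its reduced trace). -/
def redTrace : B →ₗ[K] K :=
  (2 : K)⁻¹ • (LinearMap.trace K B ∘ₗ LinearMap.mul K B)

/-- The natural involution `x ↦ Tr(x) - x`. -/
def conj (x : B) : B := algebraMap K B (redTrace K x) - x

/-- The bilinear form `(x, y) ↦ Tr(x y)`. -/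
def redTraceForm : LinearMap.BilinForm K B :=
  (LinearMap.mul K B).compr₂ (redTrace K)

end Algebra

section Orders

variable {R : Type*} (K : Type*) {B : Type*} [CommRing R] [Field K] [Algebra R K]
  [Ring B] [Algebra K B] [Algebra R B] [IsScalarTower R K B]

/-- The dual lattice `Λ^∨ = {x ∈ B : Tr(x Λ) ⊆ R}`. -/
def dualLattice (Λ : Submodule R B) : Submodule R B :=
  (redTraceForm K).dualSubmodule Λ

/-- An order of `B`: a subring containing `R` which is a finitely generated `R`-module
spanning `B` over `K`. -/
def IsOrder (O : Subalgebra R B) : Prop :=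
  Submodule.IsLattice K (Subalgebra.toSubmodule O)

/-- `e` is a basis of the `R`-submodule `Λ` of `B`. -/
def IsBasisOf {ι : Type*} (Λ : Submodule R B) (e : ι → B) : Prop :=
  LinearIndependent R e ∧ Submodule.span R (Set.range e) = Λ

/-- The ternary quadratic form `⟨1, a, b⟩ = x² + a y² + b z²` over `R`. -/
def ternaryForm (a b : R) : QuadraticForm R (Fin 3 → R) :=
  QuadraticMap.weightedSumSquares R ![1, a, b]

/-- The order `O` is in correspondence with the ternary form `f = ⟨1, a, b⟩`: it is isomorphic to
`C₀(f)`, the even part of the Clifford algebra of `f`. -/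
def Corresponds (O : Subalgebra R B) (a b : R) : Prop :=
  Nonempty (O ≃ₐ[R] CliffordAlgebra.even (ternaryForm a b))

/-- A good basis `{1, e₁, e₂, e₃}` of an order `O` in correspondence with `⟨1, a, b⟩`. -/
structure IsGoodBasis (O : Subalgebra R B) (a b : R) (e : Fin 4 → B) : Prop where
  isBasis : IsBasisOf (Subalgebra.toSubmodule O) e
  zero : e 0 = 1
  sq_one : e 1 * e 1 = algebraMap R B (-(a * b))
  sq_two : e 2 * e 2 = algebraMap R B (-b)
  sq_three : e 3 * e 3 = algebraMap R B (-a)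
  one_two : e 1 * e 2 = (-b) • e 3
  two_three : e 2 * e 3 = -e 1
  three_one : e 3 * e 1 = (-a) • e 2
  two_one : e 2 * e 1 = b • e 3
  three_two : e 3 * e 2 = e 1
  one_three : e 1 * e 3 = a • e 2

/-- A quasi-good basis of `O`: a basis `{1, e₁, e₂, e₃}` of `O` that is congruent modulo
`𝔭 O` to a good basis `{1, e₁', e₂', e₃'}` of `O`, where `𝔭` is the maximal ideal of `R`. -/
def IsQuasiGoodBasis [IsLocalRing R] (O : Subalgebra R B) (a b : R) (e : Fin 4 → B) : Prop :=
  IsBasisOf (Subalgebra.toSubmodule O) e ∧ e 0 = 1 ∧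
    ∃ e' : Fin 4 → B, IsGoodBasis O a b e' ∧
      ∀ i : Fin 4, e' i - e i ∈ IsLocalRing.maximalIdeal R • Subalgebra.toSubmodule O

/-- The Gram matrix `M_E = (Tr(fᵢ conj(fⱼ)))`, `1 ≤ i, j ≤ 3`, of `E = {f₀, f₁, f₂, f₃}`. -/
def gramMatrix (f : Fin 4 → B) : Matrix (Fin 3) (Fin 3) K :=
  Matrix.of fun i j => redTrace K (f i.succ * conj K (f j.succ))

/-- `E† = {1, e₁, e₂, e₃}` with `eᵢ = 4ab fⱼ conj(fₖ)`, `(i, j, k)` an even permutation of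
`(1, 2, 3)`. -/
def dagger (a b : R) (f : Fin 4 → B) : Fin 4 → B :=
  ![1,
    (4 * a * b) • (f 2 * conj K (f 3)),
    (4 * a * b) • (f 3 * conj K (f 1)),
    (4 * a * b) • (f 1 * conj K (f 2))]

/-- Congruence `M ≡ N` modulo `M₃(I)` of two `3 × 3` matrices over `K`, for an ideal `I` of `R`:
all entries of `M - N` are images of elements of `I`. -/
def MatrixCongr (I : Ideal R) (M N : Matrix (Fin 3) (Fin 3) K) : Prop :=
  ∀ i j, ∃ c ∈ I, M i j - N i j = algebraMap R K c

end Orders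

end QuatOrder

end

noncomputable section

namespace QuatOrder

/-! The problem reduces to Gram–Schmidt over `R` for the form `⟨1, a, b⟩`. Fix a good basis `{1, g
0, g 1, g 2}` of `O`, carried over from the even Clifford algebra. A trace-zero element of the dual
lattice has coordinates `p` in `R³` (`exists_dualComb_of_mem_dualLattice`), and `4ab x conj(y)` has
scalar part the pairing of the coordinate vectors under `⟨1, a, b⟩` and pure part their cross
product (`dualComb_mul_conj`). Hence `2ab M` is the Gram matrix of the vectors `p i`, and `E†` is a
polynomial expression in them, `daggerFamily`.

If the vectors were exactly orthogonal of norms `1, a, b`, then `E†` would be a good basis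
(`isGoodTriple_daggerFamily`). The congruence hypothesis says this nearly holds, with errors in `a²
𝔭`. Gram–Schmidt divides only by the norms `1` and `a`, and rescales by square roots of elements of
`1 + 𝔭`, available by Hensel since `2` is a unit. So it moves the vectors only modulo `𝔭`
(`exists_orthogonal_congr`). The norm of the third vector is controlled by the determinant
hypothesis. Reducing `daggerFamily` modulo `𝔭` then gives the required congruence of bases. -/

/-- The multiplication table of the pure part of a good basis. -/
structure IsGoodTriple {R A : Type*} [CommRing R] [Ring A] [Algebra R A] (a b : R)
    (e₁ e₂ e₃ : A) : Prop where
  sq_one : e₁ * e₁ = (-(a * b)) • (1 : A)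
  sq_two : e₂ * e₂ = (-b) • (1 : A)
  sq_three : e₃ * e₃ = (-a) • (1 : A)
  one_two : e₁ * e₂ = (-b) • e₃
  two_three : e₂ * e₃ = -e₁
  three_one : e₃ * e₁ = (-a) • e₂
  two_one : e₂ * e₁ = b • e₃
  three_two : e₃ * e₂ = e₁
  one_three : e₁ * e₃ = a • e₂

/-! ### Good triples from anticommuting elements. -/

section Triples

variable {R A : Type*} [CommRing R] [Ring A] [Algebra R A]

/-- Used twice: with `l = 1` for the generators of the Clifford algebra, and with `l = -4ab` for
orthogonal trace-zero elements of the dual lattice. -/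
theorem isGoodTriple_of_anticommute {l α β γ : R} {x y z : A}
    (hx : x * x = α • (1 : A)) (hy : y * y = β • (1 : A)) (hz : z * z = γ • (1 : A))
    (hyx : y * x = -(x * y)) (hzx : z * x = -(x * z)) (hzy : z * y = -(y * z))
    {a b : R} (hα : l * α = 1) (hβ : l * β = a) (hγ : l * γ = b) :
    IsGoodTriple a b (l • (y * z)) (l • (z * x)) (l • (x * y)) := by
  have hx' (w : A) : x * (x * w) = α • w := by rw [← mul_assoc, hx, smul_mul_assoc, one_mul]
  have hy' (w : A) : y * (y * w) = β • w := by rw [← mul_assoc, hy, smul_mul_assoc, one_mul]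
  have hyx' (w : A) : y * (x * w) = -(x * (y * w)) := by
    rw [← mul_assoc, hyx, neg_mul, mul_assoc]
  have hzx' (w : A) : z * (x * w) = -(x * (z * w)) := by
    rw [← mul_assoc, hzx, neg_mul, mul_assoc]
  have hzy' (w : A) : z * (y * w) = -(y * (z * w)) := by
    rw [← mul_assoc, hzy, neg_mul, mul_assoc]
  subst hβ hγ
  constructor <;>
  simp only [smul_mul_assoc, mul_smul_comm, mul_assoc, hx, hy, hz, hyx, hzx, hzy, hx', hy',
    hyx', hzx', hzy', mul_neg, neg_mul, neg_neg, smul_neg, neg_smul, smul_smul, mul_one] <;>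
  first
  | (congr 2; ring1)
  | (congr 1; linear_combination (l * β) * hα)
  | (congr 2; linear_combination (l * β) * hα)
  | (congr 2; linear_combination (l * γ) * hα)
  | (congr 2; linear_combination l * hα)

end Triples

/-! ### Gram–Schmidt over a Henselian local domain. -/

section GramSchmidt

variable {R : Type*} [CommRing R]

/-- The bilinear form of the diagonal form `⟨1, a, b⟩`. -/
def diagPairing (a b : R) (x y : Fin 3 → R) : R :=
  x 0 * y 0 + a * (x 1 * y 1) + b * (x 2 * y 2)

theorem diagPairing_comm (a b : R) (x y : Fin 3 → R) :
    diagPairing a b x y = diagPairing a b y x := by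
  simp only [diagPairing]; ring

theorem diagPairing_smul_left (a b c : R) (x y : Fin 3 → R) :
    diagPairing a b (c • x) y = c * diagPairing a b x y := by
  simp only [diagPairing, Pi.smul_apply, smul_eq_mul]; ring

theorem diagPairing_smul_right (a b c : R) (x y : Fin 3 → R) :
    diagPairing a b x (c • y) = c * diagPairing a b x y := by
  simp only [diagPairing, Pi.smul_apply, smul_eq_mul]; ring

theorem diagPairing_sub_left (a b : R) (x y z : Fin 3 → R) :
    diagPairing a b (x - y) z = diagPairing a b x z - diagPairing a b y z := by
  simp only [diagPairing, Pi.sub_apply]; ring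

theorem diagPairing_sub_right (a b : R) (x y z : Fin 3 → R) :
    diagPairing a b x (y - z) = diagPairing a b x y - diagPairing a b x z := by
  simp only [diagPairing, Pi.sub_apply]; ring

/-- The Gram determinant of three vectors for the diagonal form `⟨1, a, b⟩`. -/
theorem det_sq_mul_eq_gram (a b : R) (p : Fin 3 → Fin 3 → R) :
    (Matrix.of p).det ^ 2 * (a * b) =
      (Matrix.of fun i j => diagPairing a b (p i) (p j)).det := by
  simp only [Matrix.det_fin_three, diagPairing, Matrix.of_apply]; ring

variable {I : Ideal R}

/-- Hensel's lemma for `X² - x` at the approximate root `1`, where the derivative is the unit `2`.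
-/
theorem exists_sq_eq_of_sub_one_mem [HenselianRing R I] (h2 : IsUnit (2 : R)) {x : R}
    (hx : x - 1 ∈ I) : ∃ s, s ^ 2 = x ∧ s - 1 ∈ I := by
  obtain ⟨s, hs, hs1⟩ := HenselianRing.is_henselian (I := I) (Polynomial.X ^ 2 - Polynomial.C x)
    (Polynomial.monic_X_pow_sub_C x two_ne_zero) 1
    (by simpa using I.neg_mem hx) (by simpa [one_add_one_eq_two] using h2.map (Ideal.Quotient.mk I))
  refine ⟨s, ?_, hs1⟩
  simpa [sub_eq_zero] using hs

theorem exists_mul_eq_one_of_sub_one_mem [IsLocalRing R] {s : R}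
    (hs : s - 1 ∈ IsLocalRing.maximalIdeal R) :
    ∃ t, t * s = 1 ∧ t - 1 ∈ IsLocalRing.maximalIdeal R := by
  have hu : IsUnit s := by
    by_contra h
    have h1 : s ∈ IsLocalRing.maximalIdeal R := h
    have := (IsLocalRing.maximalIdeal R).sub_mem h1 hs
    rw [sub_sub_cancel] at this
    exact (Ideal.ne_top_iff_one _).1 (IsLocalRing.maximalIdeal.isMaximal R).ne_top this
  obtain ⟨t, ht⟩ := hu.exists_left_inv
  refine ⟨t, ht, ?_⟩
  have : t - 1 = -t * (s - 1) := by linear_combination ht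
  rw [this]
  exact Ideal.mul_mem_left _ _ hs

theorem exists_mul_sq_eq_one [IsLocalRing R] [HenselianRing R (IsLocalRing.maximalIdeal R)]
    (h2 : IsUnit (2 : R)) {x : R} (hx : x - 1 ∈ IsLocalRing.maximalIdeal R) :
    ∃ t, t ^ 2 * x = 1 ∧ t - 1 ∈ IsLocalRing.maximalIdeal R := by
  obtain ⟨s, rfl, hs⟩ := exists_sq_eq_of_sub_one_mem h2 hx
  obtain ⟨t, ht, ht1⟩ := exists_mul_eq_one_of_sub_one_mem hs
  exact ⟨t, by linear_combination (t * s + 1) * ht, ht1⟩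

theorem det_sub_det_mem {p q : Fin 3 → Fin 3 → R} (h : ∀ i j, q i j - p i j ∈ I) :
    (Matrix.of q).det - (Matrix.of p).det ∈ I := by
  simp only [← Ideal.Quotient.eq] at h ⊢
  simp only [RingHom.map_det]
  congr 1
  ext i j
  exact h i j

/-- Approximately orthogonal vectors with respect to `⟨1, a, b⟩` can be deformed, modulo the
maximal ideal, to exactly orthogonal ones. -/
theorem exists_orthogonal_congr [IsDomain R] [IsLocalRing R]
    [HenselianRing R (IsLocalRing.maximalIdeal R)] (h2 : IsUnit (2 : R))
    {a b : R} (ha : a ≠ 0) (p : Fin 3 → Fin 3 → R)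
    (h00 : ∃ y ∈ IsLocalRing.maximalIdeal R, diagPairing a b (p 0) (p 0) = 1 + a ^ 2 * y)
    (h01 : ∃ y ∈ IsLocalRing.maximalIdeal R, diagPairing a b (p 0) (p 1) = a ^ 2 * y)
    (h02 : ∃ y ∈ IsLocalRing.maximalIdeal R, diagPairing a b (p 0) (p 2) = a ^ 2 * y)
    (h12 : ∃ y ∈ IsLocalRing.maximalIdeal R, diagPairing a b (p 1) (p 2) = a ^ 2 * y)
    (h11 : ∃ y ∈ IsLocalRing.maximalIdeal R, diagPairing a b (p 1) (p 1) = a + a ^ 2 * y)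
    (hdet : (Matrix.of p).det ^ 2 - 1 ∈ IsLocalRing.maximalIdeal R) :
    ∃ q : Fin 3 → Fin 3 → R, (∀ i j, q i j - p i j ∈ IsLocalRing.maximalIdeal R) ∧
      ∀ i j, diagPairing a b (q i) (q j) = if i = j then ![1, a, b] i else 0 := by
  set m := IsLocalRing.maximalIdeal R
  obtain ⟨y00, m00, h00⟩ := h00
  obtain ⟨y01, m01, h01⟩ := h01
  obtain ⟨y02, m02, h02⟩ := h02
  obtain ⟨y12, m12, h12⟩ := h12
  obtain ⟨y11, m11, h11⟩ := h11
  obtain ⟨t, ht, htm⟩ := exists_mul_sq_eq_one h2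
    (x := 1 + a ^ 2 * y00) (by rw [add_sub_cancel_left]; exact m.mul_mem_left _ m00)
  -- After its projection to `t • p 0` is removed, `p 1` has norm `a` times this `x`; so `s`
  -- restores the norm to exactly `a`.
  obtain ⟨s, hs, hsm⟩ := exists_mul_sq_eq_one h2
    (x := 1 + a * (y11 - a ^ 2 * t ^ 2 * y01 ^ 2)) (by
      rw [add_sub_cancel_left]
      refine m.mul_mem_left _ (m.sub_mem m11 ?_)
      rw [sq y01]
      exact m.mul_mem_left _ (m.mul_mem_left _ m01))
  have hsmul {c : R} (hc : c - 1 ∈ m) {x x' : R} (hx : x - x' ∈ m) : c * x - x' ∈ m := by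
    have : c * x - x' = (c - 1) * x + (x - x') := by ring
    rw [this]
    exact m.add_mem (m.mul_mem_right _ hc) hx
  have hsub {c x x' y : R} (hc : c ∈ m) (hx : x - x' ∈ m) : x - c * y - x' ∈ m := by
    rw [sub_right_comm]
    exact m.sub_mem hx (m.mul_mem_right _ hc)
  obtain ⟨q0, hq0⟩ : ∃ q0, q0 = t • p 0 := ⟨_, rfl⟩
  have e00 : diagPairing a b q0 q0 = 1 := by
    rw [hq0, diagPairing_smul_left, diagPairing_smul_right, h00]
    linear_combination ht
  have f1 : diagPairing a b q0 (p 1) = t * (a ^ 2 * y01) := by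
    rw [hq0, diagPairing_smul_left, h01]
  have f2 : diagPairing a b q0 (p 2) = t * (a ^ 2 * y02) := by
    rw [hq0, diagPairing_smul_left, h02]
  have c0 (j) : q0 j - p 0 j ∈ m := by
    rw [hq0]
    exact hsmul htm (by simp)
  clear hq0
  obtain ⟨q1, hq1⟩ : ∃ q1, q1 = s • (p 1 - (t * (a ^ 2 * y01)) • q0) := ⟨_, rfl⟩
  have e01 : diagPairing a b q0 q1 = 0 := by
    rw [hq1, diagPairing_smul_right, diagPairing_sub_right, diagPairing_smul_right, e00, f1]
    ring
  have e11 : diagPairing a b q1 q1 = a := by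
    simp only [hq1, diagPairing_smul_right, diagPairing_sub_right, diagPairing_smul_left,
      diagPairing_sub_left, e00, f1, h11, diagPairing_comm a b (p 1) q0]
    linear_combination a * hs
  -- The explicit factor `a` cancels the norm of `q1`, so the projection coefficient `k` is
  -- integral, and it lies in `m`.
  have f12 : diagPairing a b q1 (p 2) = a * (s * a * (y12 - a ^ 2 * t ^ 2 * y01 * y02)) := by
    simp only [hq1, diagPairing_smul_left, diagPairing_sub_left, f2, h12]
    ring
  have c1 (j) : q1 j - p 1 j ∈ m := by
    rw [hq1]
    exact hsmul hsm (hsub (m.mul_mem_left _ (m.mul_mem_left _ m01)) (by simp))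
  clear hq1
  set k := s * a * (y12 - a ^ 2 * t ^ 2 * y01 * y02)
  have hkm : k ∈ m := m.mul_mem_left _ (m.sub_mem m12 (m.mul_mem_left _ m02))
  clear_value k
  obtain ⟨q2, hq2⟩ : ∃ q2, q2 = p 2 - (t * (a ^ 2 * y02)) • q0 - k • q1 := ⟨_, rfl⟩
  have e02 : diagPairing a b q0 q2 = 0 := by
    simp only [hq2, diagPairing_smul_right, diagPairing_sub_right, e00, e01, f2]
    ring
  have e12 : diagPairing a b q1 q2 = 0 := by
    simp only [hq2, diagPairing_smul_right, diagPairing_sub_right, e11, e01, f12,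
      diagPairing_comm a b q1 q0]
    ring
  have c2 (j) : q2 j - p 2 j ∈ m := by
    rw [hq2]
    exact hsub hkm (hsub (m.mul_mem_left _ (m.mul_mem_left _ m02)) (by simp))
  clear hq2
  have hd := det_sub_det_mem (I := m) (p := p) (q := ![q0, q1, q2])
    (by intro i j; fin_cases i; exacts [c0 j, c1 j, c2 j])
  have hgram := det_sq_mul_eq_gram a b ![q0, q1, q2]
  set δ := (Matrix.of ![q0, q1, q2]).det
  -- The Gram matrix is now diagonal with entries `1, a, ⟨q2, q2⟩` and has determinant `δ² a b`,
  -- which fixes the last norm up to a square in `1 + m`.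
  have e22 : diagPairing a b q2 q2 = b * δ ^ 2 := by
    simp [Matrix.det_fin_three, e00, e01, e11, e02, e12, diagPairing_comm a b q1 q0,
      diagPairing_comm a b q2 q0, diagPairing_comm a b q2 q1] at hgram
    exact mul_left_cancel₀ ha (by linear_combination -hgram)
  have hδ : δ ^ 2 - 1 ∈ m := by
    have : δ ^ 2 - 1 = (δ - (Matrix.of p).det) * (δ + (Matrix.of p).det) +
      ((Matrix.of p).det ^ 2 - 1) := by ring
    rw [this]
    exact m.add_mem (m.mul_mem_right _ hd) hdet
  obtain ⟨r, hr, hrm⟩ : ∃ r, r ^ 2 * δ ^ 2 = 1 ∧ r - 1 ∈ m :=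
    exists_mul_sq_eq_one h2 hδ
  refine ⟨![q0, q1, r • q2], ?_, ?_⟩
  · intro i j
    fin_cases i
    exacts [c0 j, c1 j, hsmul hrm (c2 j)]
  · intro i j
    fin_cases i <;> fin_cases j <;>
      simp [diagPairing_smul_left, diagPairing_smul_right, e00, e01, e11, e02, e12,
        diagPairing_comm a b q1 q0, diagPairing_comm a b q2 q0, diagPairing_comm a b q2 q1, e22]
    linear_combination b * hr

end GramSchmidt

/-! ### A good basis of the even Clifford algebra. -/

section Clifford

variable {R A : Type*} [CommRing R] [Ring A] [Algebra R A]

theorem IsGoodTriple.map {A' : Type*} [Ring A'] [Algebra R A'] {a b : R} {e₁ e₂ e₃ : A}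
    (h : IsGoodTriple a b e₁ e₂ e₃) (φ : A →ₐ[R] A') :
    IsGoodTriple a b (φ e₁) (φ e₂) (φ e₃) := by
  constructor
  · rw [← map_mul, h.sq_one, map_smul, map_one]
  · rw [← map_mul, h.sq_two, map_smul, map_one]
  · rw [← map_mul, h.sq_three, map_smul, map_one]
  · rw [← map_mul, h.one_two, map_smul]
  · rw [← map_mul, h.two_three, map_neg]
  · rw [← map_mul, h.three_one, map_smul]
  · rw [← map_mul, h.two_one, map_smul]
  · rw [← map_mul, h.three_two]
  · rw [← map_mul, h.one_three, map_smul]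

theorem IsGoodTriple.mul_mem_span {a b : R} {e₁ e₂ e₃ : A} (h : IsGoodTriple a b e₁ e₂ e₃)
    {s t : A} (hs : s ∈ Submodule.span R (Set.range ![1, e₁, e₂, e₃]))
    (ht : t ∈ Submodule.span R (Set.range ![1, e₁, e₂, e₃])) :
    s * t ∈ Submodule.span R (Set.range ![1, e₁, e₂, e₃]) := by
  have mem (i) : ![1, e₁, e₂, e₃] i ∈ Submodule.span R (Set.range ![1, e₁, e₂, e₃]) :=
    Submodule.subset_span ⟨i, rfl⟩
  have m0 : 1 ∈ Submodule.span R (Set.range ![1, e₁, e₂, e₃]) := mem 0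
  have m1 : e₁ ∈ Submodule.span R (Set.range ![1, e₁, e₂, e₃]) := mem 1
  have m2 : e₂ ∈ Submodule.span R (Set.range ![1, e₁, e₂, e₃]) := mem 2
  have m3 : e₃ ∈ Submodule.span R (Set.range ![1, e₁, e₂, e₃]) := mem 3
  have hle : Submodule.span R (Set.range ![1, e₁, e₂, e₃]) *
      Submodule.span R (Set.range ![1, e₁, e₂, e₃]) ≤
      Submodule.span R (Set.range ![1, e₁, e₂, e₃]) := by
    rw [Submodule.span_mul_span, Submodule.span_le]
    rintro _ ⟨_, ⟨i, rfl⟩, _, ⟨j, rfl⟩, rfl⟩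
    fin_cases i <;> fin_cases j <;>
      simp only [Fin.zero_eta, Fin.mk_one, Fin.reduceFinMk, Matrix.cons_val, one_mul, mul_one,
        h.sq_one, h.sq_two, h.sq_three, h.one_two, h.two_three, h.three_one, h.two_one,
        h.three_two, h.one_three, SetLike.mem_coe] <;>
      first
      | assumption
      | (apply Submodule.smul_mem; assumption)
      | (apply Submodule.neg_mem; assumption)
  exact hle (Submodule.mul_mem_mul hs ht)

/-- The images of the standard vectors anticommute with squares `1, a, b`. The span of `1` and their
pairwise products is closed under multiplication, so it is the whole even part. Only generation is
needed here: independence will follow from a dimension count in `B`. -/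
theorem exists_isGoodTriple_even (a b : R) :
    ∃ e₁ e₂ e₃ : CliffordAlgebra.even (ternaryForm a b), IsGoodTriple a b e₁ e₂ e₃ ∧
      Submodule.span R (Set.range ![1, e₁, e₂, e₃]) = ⊤ := by
  set Q := ternaryForm a b
  have hQ (v : Fin 3 → R) : Q v = v 0 * v 0 + a * (v 1 * v 1) + b * (v 2 * v 2) := by
    simp [Q, ternaryForm, QuadraticMap.weightedSumSquares_apply, Fin.sum_univ_three]
  let v (i : Fin 3) : CliffordAlgebra Q := CliffordAlgebra.ι Q (Pi.single i 1)
  have hsq (i) : v i * v i = (![1, a, b] i) • (1 : CliffordAlgebra Q) := by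
    rw [CliffordAlgebra.ι_sq_scalar, Algebra.algebraMap_eq_smul_one, hQ]
    congr 1
    fin_cases i <;> simp
  have hanti {i j} (hij : i ≠ j) : v j * v i = -(v i * v j) := by
    rw [eq_neg_iff_add_eq_zero]
    refine CliffordAlgebra.ι_mul_ι_add_swap_of_isOrtho ?_
    rw [QuadraticMap.isOrtho_def, hQ, hQ, hQ]
    fin_cases i <;> fin_cases j <;> simp [add_comm] at hij ⊢
  have hx : v 0 * v 0 = (1 : R) • (1 : CliffordAlgebra Q) := hsq 0
  have hy : v 1 * v 1 = a • (1 : CliffordAlgebra Q) := hsq 1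
  have hz : v 2 * v 2 = b • (1 : CliffordAlgebra Q) := hsq 2
  have hyx : v 1 * v 0 = -(v 0 * v 1) := hanti (by decide)
  have hzx : v 2 * v 0 = -(v 0 * v 2) := hanti (by decide)
  have hzy : v 2 * v 1 = -(v 1 * v 2) := hanti (by decide)
  have htriple := isGoodTriple_of_anticommute hx hy hz hyx hzx hzy (one_mul 1) (one_mul a)
    (one_mul b)
  simp only [one_smul] at htriple
  have hmem (i j) : v i * v j ∈ CliffordAlgebra.even Q :=
    CliffordAlgebra.ι_mul_ι_mem_evenOdd_zero Q _ _
  set S := Submodule.span R (Set.range ![1, v 1 * v 2, v 2 * v 0, v 0 * v 1])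
  have mem (i) : ![1, v 1 * v 2, v 2 * v 0, v 0 * v 1] i ∈ S :=
    Submodule.subset_span ⟨i, rfl⟩
  have m0 : 1 ∈ S := mem 0
  have m1 : v 1 * v 2 ∈ S := mem 1
  have m2 : v 2 * v 0 ∈ S := mem 2
  have m3 : v 0 * v 1 ∈ S := mem 3
  have hvv (i j) : v i * v j ∈ S := by
    by_cases hij : i = j
    · rw [hij, hsq]
      exact S.smul_mem _ m0
    · have hneg : v j * v i ∈ S → v i * v j ∈ S := fun h => by
        rw [hanti (Ne.symm hij)]
        exact S.neg_mem h
      fin_cases i <;> fin_cases j <;> first | exact absurd rfl hij | assumption |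
        exact hneg (by assumption)
  have hι (m : Fin 3 → R) : CliffordAlgebra.ι Q m = ∑ i, m i • v i := by
    conv_lhs => rw [pi_eq_sum_univ' m]
    simp only [map_sum, map_smul, v]
  have hspan (x) (hx : x ∈ CliffordAlgebra.evenOdd Q 0) : x ∈ S := by
    induction x, hx using CliffordAlgebra.even_induction with
    | algebraMap r =>
      rw [Algebra.algebraMap_eq_smul_one]
      exact S.smul_mem _ m0
    | add x y _ _ hx hy => exact S.add_mem hx hy
    | ι_mul_ι_mul m₁ m₂ x _ hx =>
      refine htriple.mul_mem_span ?_ hx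
      rw [hι, hι, Finset.sum_mul_sum]
      refine Submodule.sum_mem _ fun i _ => Submodule.sum_mem _ fun j _ => ?_
      rw [smul_mul_smul_comm]
      exact Submodule.smul_mem _ _ (hvv i j)
  refine ⟨⟨_, hmem 1 2⟩, ⟨_, hmem 2 0⟩, ⟨_, hmem 0 1⟩, ?_, ?_⟩
  · constructor <;> refine Subtype.ext ?_
    exacts [htriple.sq_one, htriple.sq_two, htriple.sq_three, htriple.one_two, htriple.two_three,
      htriple.three_one, htriple.two_one, htriple.three_two, htriple.one_three]
  · refine Submodule.map_injective_of_injective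
      (f := (CliffordAlgebra.even Q).val.toLinearMap) Subtype.val_injective ?_
    refine le_antisymm (Submodule.map_mono le_top) ?_
    rintro _ ⟨x, -, rfl⟩
    rw [Submodule.map_span, ← Set.range_comp]
    convert hspan x.1 x.2 using 3
    · ext i
      fin_cases i <;> rfl
    · rfl

end Clifford

/-! ### Trace-zero elements of the quaternion algebra in dual coordinates. -/

section Field

variable {K B : Type*} [Field K] [Ring B] [Algebra K B]

/-- The linear combination of `e₁, e₂, e₃` with coefficients `c`. -/
def pureComb {R A : Type*} [CommRing R] [Ring A] [Algebra R A] (g : Fin 3 → A) (c : Fin 3 → R) :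
    A :=
  c 0 • g 0 + c 1 • g 1 + c 2 • g 2

/-- The trace zero element of the dual lattice with coordinates `p` in the basis dual to a good
basis (up to sign). -/
def dualComb (α β : K) (g : Fin 3 → B) (p : Fin 3 → K) : B :=
  pureComb g ![p 0 / (2 * α * β), p 1 / (2 * β), p 2 / (2 * α)]

variable {α β : K} {g : Fin 3 → B}

/-- The denominators in `dualComb` are those for which, after extracting one common scalar, the pure
part is the plain cross product, free of `α` and `β`. -/
theorem dualComb_mul_dualComb (h : IsGoodTriple α β (g 0) (g 1) (g 2)) (hα : α ≠ 0) (hβ : β ≠ 0)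
    (h2 : (2 : K) ≠ 0) (p q : Fin 3 → K) :
    dualComb α β g p * dualComb α β g q =
      (-(4 * α * β)⁻¹) • (diagPairing α β p q • (1 : B) + pureComb g (crossProduct p q)) := by
  have h4 : (4 : K) = 2 * 2 := by norm_num
  simp only [dualComb, pureComb, cross_apply, Matrix.cons_val, add_mul, mul_add, smul_mul_assoc,
    mul_smul_comm, h.sq_one, h.sq_two, h.sq_three, h.one_two, h.two_three, h.three_one, h.two_one,
    h.three_two, h.one_three, diagPairing, h4]
  match_scalars <;> field_simp <;> ring

theorem redTrace_eq_sum {ι : Type*} [Fintype ι] [DecidableEq ι] (bas : Module.Basis ι K B)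
    (x : B) : redTrace K x = 2⁻¹ * ∑ i, bas.repr (x * bas i) i := by
  simp [redTrace, LinearMap.trace_eq_matrix_trace K bas, Matrix.trace, LinearMap.toMatrix_apply]

theorem redTrace_one (h2 : (2 : K) ≠ 0) (hB : Module.finrank K B = 4) :
    redTrace K (1 : B) = 2 := by
  have : Module.Finite K B := Module.finite_of_finrank_pos (by omega)
  have : LinearMap.mul K B 1 = LinearMap.id := by ext; simp
  rw [redTrace, LinearMap.smul_apply, LinearMap.comp_apply, this, LinearMap.trace_id, hB]
  push_cast
  rw [smul_eq_mul, show (4 : K) = 2 * 2 by norm_num, inv_mul_cancel_left₀ h2]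

/-- Left multiplication by `g i` sends each basis vector to a multiple of a different one, so its
matrix has zero diagonal. -/
theorem IsGoodTriple.redTrace_eq_zero (h : IsGoodTriple α β (g 0) (g 1) (g 2))
    (bas : Module.Basis (Fin 4) K B) (hbas : ⇑bas = ![1, g 0, g 1, g 2]) (i : Fin 3) :
    redTrace K (g i) = 0 := by
  have r0 : bas.repr 1 = Finsupp.single 0 1 := by rw [← bas.repr_self, hbas]; rfl
  have r1 : bas.repr (g 0) = Finsupp.single 1 1 := by rw [← bas.repr_self, hbas]; rfl
  have r2 : bas.repr (g 1) = Finsupp.single 2 1 := by rw [← bas.repr_self, hbas]; rfl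
  have r3 : bas.repr (g 2) = Finsupp.single 3 1 := by rw [← bas.repr_self, hbas]; rfl
  rw [redTrace_eq_sum bas, Fin.sum_univ_four, hbas]
  fin_cases i <;>
    simp [h.sq_one, h.sq_two, h.sq_three, h.one_two, h.two_three, h.three_one, h.two_one,
      h.three_two, h.one_three, r0, r1, r2, r3]

theorem redTrace_comb (htr1 : redTrace K (1 : B) = 2) (htr : ∀ i, redTrace K (g i) = 0)
    (r : K) (c : Fin 3 → K) : redTrace K (r • (1 : B) + pureComb g c) = 2 * r := by
  simp [pureComb, htr, htr1, mul_comm]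

theorem conj_eq_neg {x : B} (hx : redTrace K x = 0) : conj K x = -x := by
  simp [conj, hx]

theorem redTrace_dualComb (htr : ∀ i, redTrace K (g i) = 0) (p : Fin 3 → K) :
    redTrace K (dualComb α β g p) = 0 := by
  simp [dualComb, pureComb, htr]

theorem dualComb_mul_conj (h : IsGoodTriple α β (g 0) (g 1) (g 2)) (hα : α ≠ 0) (hβ : β ≠ 0)
    (h2 : (2 : K) ≠ 0) (htr : ∀ i, redTrace K (g i) = 0) (p q : Fin 3 → K) :
    dualComb α β g p * conj K (dualComb α β g q) =
      (4 * α * β)⁻¹ • (diagPairing α β p q • (1 : B) + pureComb g (crossProduct p q)) := by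
  rw [conj_eq_neg (redTrace_dualComb htr q), mul_neg, dualComb_mul_dualComb h hα hβ h2, neg_smul,
    neg_neg]

/-- The trace form is diagonal on the `g i`, with negative entries `-2αβ, -2β, -2α`; hence the sign
in the coordinates. -/
theorem exists_eq_dualComb (h : IsGoodTriple α β (g 0) (g 1) (g 2)) (hα : α ≠ 0) (hβ : β ≠ 0)
    (h2 : (2 : K) ≠ 0) (bas : Module.Basis (Fin 4) K B) (hbas : ⇑bas = ![1, g 0, g 1, g 2])
    (htr1 : redTrace K (1 : B) = 2) (htr : ∀ i, redTrace K (g i) = 0)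
    {x : B} (hx : redTrace K x = 0) :
    x = dualComb α β g fun i => -redTrace K (x * g i) := by
  obtain ⟨r, c, rfl⟩ : ∃ (r : K) (c : Fin 3 → K), x = r • (1 : B) + pureComb g c := by
    refine ⟨bas.repr x 0, fun i => bas.repr x i.succ, ?_⟩
    conv_lhs => rw [← bas.sum_repr x, Fin.sum_univ_four, hbas]
    simp [pureComb, add_assoc]
  rw [redTrace_comb htr1 htr] at hx
  obtain rfl : r = 0 := by simpa [h2] using hx
  have t0 : redTrace K ((((0 : K) • (1 : B)) + pureComb g c) * g 0) = -(2 * α * β) * c 0 := by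
    simp only [pureComb, zero_smul, zero_add, add_mul, smul_mul_assoc, h.sq_one, h.two_one,
      h.three_one, map_add, map_smul, htr, htr1, smul_eq_mul]
    ring
  have t1 : redTrace K ((((0 : K) • (1 : B)) + pureComb g c) * g 1) = -(2 * β) * c 1 := by
    simp only [pureComb, zero_smul, zero_add, add_mul, smul_mul_assoc, h.sq_two, h.one_two,
      h.three_two, map_add, map_smul, htr, htr1, smul_eq_mul]
    ring
  have t2 : redTrace K ((((0 : K) • (1 : B)) + pureComb g c) * g 2) = -(2 * α) * c 2 := by
    simp only [pureComb, zero_smul, zero_add, add_mul, smul_mul_assoc, h.sq_three, h.one_three,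
      h.two_three, map_add, map_smul, map_neg, htr, htr1, smul_eq_mul]
    ring
  rw [dualComb, t0, t1, t2, zero_smul, zero_add]
  congr 1
  ext i
  fin_cases i <;> simp <;> field_simp

/-- Orthogonal vectors of norms `1, α, β` give rise to a good triple. -/
theorem isGoodTriple_of_orthogonal (h : IsGoodTriple α β (g 0) (g 1) (g 2)) (hα : α ≠ 0)
    (hβ : β ≠ 0) (h2 : (2 : K) ≠ 0) (q : Fin 3 → Fin 3 → K)
    (hq : ∀ i j, diagPairing α β (q i) (q j) = if i = j then ![1, α, β] i else 0) :
    IsGoodTriple α β (pureComb g (crossProduct (q 1) (q 2)))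
      (pureComb g (crossProduct (q 2) (q 0))) (pureComb g (crossProduct (q 0) (q 1))) := by
  have h4 : (4 : K) ≠ 0 := by
    rw [show (4 : K) = 2 * 2 by norm_num]
    exact mul_ne_zero h2 h2
  have hl : -(4 * α * β) ≠ 0 := neg_ne_zero.2 (mul_ne_zero (mul_ne_zero h4 hα) hβ)
  have hmul {i j} (hij : i ≠ j) : dualComb α β g (q i) * dualComb α β g (q j) =
      (-(4 * α * β)⁻¹) • pureComb g (crossProduct (q i) (q j)) := by
    rw [dualComb_mul_dualComb h hα hβ h2, hq, if_neg hij, zero_smul, zero_add]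
  have hsq (i) : dualComb α β g (q i) * dualComb α β g (q i) =
      (-(4 * α * β)⁻¹ * ![1, α, β] i) • (1 : B) := by
    rw [dualComb_mul_dualComb h hα hβ h2, hq, if_pos rfl, cross_self, smul_add, smul_smul]
    simp [pureComb]
  have hanti {i j} (hij : i ≠ j) : dualComb α β g (q j) * dualComb α β g (q i) =
      -(dualComb α β g (q i) * dualComb α β g (q j)) := by
    rw [hmul hij, hmul hij.symm, ← smul_neg, ← cross_anticomm]
    simp only [pureComb, Pi.neg_apply]
    module
  -- Since `q 0` has norm `1`, its dual element squares to `-(4αβ)⁻¹`, which forces this `l`.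
  have key := isGoodTriple_of_anticommute (l := -(4 * α * β)) (hsq 0) (hsq 1) (hsq 2)
    (hanti (by decide)) (hanti (by decide)) (hanti (by decide)) (a := α) (b := β)
    (by simp; field_simp) (by simp; field_simp) (by simp; field_simp)
  rw [hmul (by decide), hmul (by decide), hmul (by decide), smul_smul, smul_smul, smul_smul,
    ← inv_neg, mul_inv_cancel₀ hl, one_smul, one_smul, one_smul] at key
  exact key

end Field

/-! ### Bases of lattices and the family attached to a triple of vectors. -/

section Lattices

theorem IsBasisOf.of_isUnit_det {R B ι : Type*} [CommRing R] [Ring B] [Algebra R B] [Fintype ι]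
    [DecidableEq ι] {Λ : Submodule R B} {g : ι → B} (hg : IsBasisOf Λ g) (M : Matrix ι ι R)
    (hM : IsUnit M.det) : IsBasisOf Λ fun i => ∑ j, M i j • g j := by
  obtain ⟨hli, rfl⟩ := hg
  have key (c : ι → R) : ∑ i, c i • ∑ j, M i j • g j = ∑ j, (Matrix.vecMul c M) j • g j := by
    simp only [Finset.smul_sum, Matrix.vecMul, dotProduct, Finset.sum_smul, smul_smul]
    exact Finset.sum_comm
  refine ⟨Fintype.linearIndependent_iff.2 fun c hc => ?_, le_antisymm ?_ ?_⟩
  · rw [key] at hc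
    have hc' : Matrix.vecMul c M = 0 := funext (Fintype.linearIndependent_iff.1 hli _ hc)
    have : c = 0 := by
      rw [← Matrix.vecMul_one c, ← Matrix.mul_nonsing_inv M hM, ← Matrix.vecMul_vecMul, hc',
        Matrix.zero_vecMul]
    exact congrFun this
  · rw [Submodule.span_le]
    rintro _ ⟨i, rfl⟩
    exact Submodule.sum_mem _ fun j _ => Submodule.smul_mem _ _ (Submodule.subset_span ⟨j, rfl⟩)
  · rw [Submodule.span_le]
    rintro _ ⟨i, rfl⟩
    have : g i = ∑ k, M⁻¹ i k • ∑ j, M k j • g j := by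
      rw [key, show Matrix.vecMul (M⁻¹ i) M = (M⁻¹ * M) i from rfl, Matrix.nonsing_inv_mul M hM]
      simp [Matrix.one_apply]
    rw [this]
    exact Submodule.sum_mem _ fun j _ => Submodule.smul_mem _ _ (Submodule.subset_span ⟨j, rfl⟩)

variable {R B : Type*} [CommRing R] [Ring B] [Algebra R B]

/-- The family `{1, e₁, e₂, e₃}` attached to a triple of vectors `p`: here `g` is the pure part of
a good basis, and `eᵢ` is `4ab fⱼ conj(fₖ)` for the dual vectors `f` with coordinates `p`. -/
def daggerFamily (a b : R) (g : Fin 3 → B) (p : Fin 3 → Fin 3 → R) : Fin 4 → B :=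
  ![1,
    diagPairing a b (p 1) (p 2) • 1 + pureComb g (crossProduct (p 1) (p 2)),
    diagPairing a b (p 2) (p 0) • 1 + pureComb g (crossProduct (p 2) (p 0)),
    diagPairing a b (p 0) (p 1) • 1 + pureComb g (crossProduct (p 0) (p 1))]

/-- The change of basis matrix is block triangular, with blocks `1` and the cofactor matrix of `p`,
whose determinant is `det(p)²`. -/
theorem isBasisOf_daggerFamily {Λ : Submodule R B} {a b : R} {g : Fin 3 → B}
    (hg : IsBasisOf Λ ![1, g 0, g 1, g 2]) {p : Fin 3 → Fin 3 → R}
    (hp : IsUnit ((Matrix.of p).det ^ 2)) : IsBasisOf Λ (daggerFamily a b g p) := by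
  let row (s : R) (c : Fin 3 → R) : Fin 4 → R := ![s, c 0, c 1, c 2]
  convert hg.of_isUnit_det (Matrix.of ![row 1 0,
    row (diagPairing a b (p 1) (p 2)) (crossProduct (p 1) (p 2)),
    row (diagPairing a b (p 2) (p 0)) (crossProduct (p 2) (p 0)),
    row (diagPairing a b (p 0) (p 1)) (crossProduct (p 0) (p 1))]) ?_ using 1
  · ext i
    fin_cases i <;> simp [daggerFamily, pureComb, Fin.sum_univ_four, row, add_assoc]
  · convert hp using 1
    simp [Matrix.det_succ_row_zero (n := 3), Fin.sum_univ_succ, Matrix.det_fin_three,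
      cross_apply, row, Fin.succAbove]
    ring

/-- The coordinates of the family are polynomials in the entries of the vectors, so they are
preserved modulo `I`. -/
theorem daggerFamily_sub_mem {I : Ideal R} {Λ : Submodule R B} {a b : R}
    {g : Fin 3 → B} (hg : IsBasisOf Λ ![1, g 0, g 1, g 2]) {p q : Fin 3 → Fin 3 → R}
    (h : ∀ i j, q i j - p i j ∈ I) (i : Fin 4) :
    daggerFamily a b g q i - daggerFamily a b g p i ∈ I • Λ := by
  have mem (i) : ![1, g 0, g 1, g 2] i ∈ Λ := hg.2 ▸ Submodule.subset_span ⟨i, rfl⟩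
  have m0 : 1 ∈ Λ := mem 0
  have m1 : g 0 ∈ Λ := mem 1
  have m2 : g 1 ∈ Λ := mem 2
  have m3 : g 2 ∈ Λ := mem 3
  have aux (j k) : diagPairing a b (q j) (q k) • (1 : B) + pureComb g (crossProduct (q j) (q k)) -
      (diagPairing a b (p j) (p k) • 1 + pureComb g (crossProduct (p j) (p k))) ∈ I • Λ := by
    have e : diagPairing a b (q j) (q k) • (1 : B) + pureComb g (crossProduct (q j) (q k)) -
      (diagPairing a b (p j) (p k) • 1 + pureComb g (crossProduct (p j) (p k))) =
      (diagPairing a b (q j) (q k) - diagPairing a b (p j) (p k)) • (1 : B) +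
      (crossProduct (q j) (q k) 0 - crossProduct (p j) (p k) 0) • g 0 +
      (crossProduct (q j) (q k) 1 - crossProduct (p j) (p k) 1) • g 1 +
      (crossProduct (q j) (q k) 2 - crossProduct (p j) (p k) 2) • g 2 := by
      simp only [pureComb]
      module
    have hq (i j) : Ideal.Quotient.mk I (q i j) = Ideal.Quotient.mk I (p i j) :=
      Ideal.Quotient.eq.2 (h i j)
    rw [e]
    refine Submodule.add_mem _ (Submodule.add_mem _ (Submodule.add_mem _ ?_ ?_) ?_) ?_ <;>
      refine Submodule.smul_mem_smul (Ideal.Quotient.eq.1 ?_) (by assumption) <;>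
      simp [diagPairing, cross_apply, hq]
  fin_cases i
  · simp [daggerFamily]
  exacts [aux 1 2, aux 2 0, aux 0 1]

end Lattices

/-! ### Transfer between `R` and `K`, and integrality of the coordinates. -/

section Orders

variable {R K B : Type*} [CommRing R] [Field K] [Algebra R K] [Ring B] [Algebra K B]
  [Algebra R B] [IsScalarTower R K B]

theorem Corresponds.exists_isGoodTriple {O : Subalgebra R B} {a b : R} (h : Corresponds O a b) :
    ∃ g : Fin 3 → B, IsGoodTriple a b (g 0) (g 1) (g 2) ∧
      Submodule.span R (Set.range ![1, g 0, g 1, g 2]) = Subalgebra.toSubmodule O := by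
  obtain ⟨φ⟩ := h
  obtain ⟨e₁, e₂, e₃, he, hspan⟩ := exists_isGoodTriple_even a b
  let ψ : CliffordAlgebra.even (ternaryForm a b) →ₐ[R] B := O.val.comp φ.symm.toAlgHom
  refine ⟨![ψ e₁, ψ e₂, ψ e₃], he.map ψ, ?_⟩
  have hr : Submodule.map ψ.toLinearMap ⊤ = Subalgebra.toSubmodule O := by
    ext x
    constructor
    · rintro ⟨y, -, rfl⟩
      exact (φ.symm y).2
    · intro hx
      exact ⟨φ ⟨x, hx⟩, trivial, by simp [ψ]⟩
  rw [← hr, ← hspan, Submodule.map_span, ← Set.range_comp]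
  congr 2
  ext i
  fin_cases i <;> simp

theorem span_field_eq_top {O : Subalgebra R B} (hO : IsOrder K O) {ι : Type*} {e : ι → B}
    (he : Submodule.span R (Set.range e) = Subalgebra.toSubmodule O) :
    Submodule.span K (Set.range e) = ⊤ := by
  have := hO.span_eq_top
  rwa [← he, Submodule.span_span_of_tower] at this

theorem IsGoodTriple.extendScalars {a b : R} {e₁ e₂ e₃ : B} (h : IsGoodTriple a b e₁ e₂ e₃) :
    IsGoodTriple (algebraMap R K a) (algebraMap R K b) e₁ e₂ e₃ := by
  constructor <;> (try simp only [← map_mul, ← map_neg, algebraMap_smul])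
  exacts [h.sq_one, h.sq_two, h.sq_three, h.one_two, h.two_three, h.three_one, h.two_one,
    h.three_two, h.one_three]

theorem IsGoodTriple.restrictScalars {a b : R} {e₁ e₂ e₃ : B}
    (h : IsGoodTriple (algebraMap R K a) (algebraMap R K b) e₁ e₂ e₃) :
    IsGoodTriple a b e₁ e₂ e₃ := by
  obtain ⟨h1, h2, h3, h4, h5, h6, h7, h8, h9⟩ := h
  simp only [← map_mul, ← map_neg, algebraMap_smul] at h1 h2 h3 h4 h5 h6 h7 h8 h9
  exact ⟨h1, h2, h3, h4, h5, h6, h7, h8, h9⟩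

theorem IsGoodTriple.isGoodBasis {O : Subalgebra R B} {a b : R} {e : Fin 4 → B}
    (h : IsGoodTriple a b (e 1) (e 2) (e 3)) (he : IsBasisOf (Subalgebra.toSubmodule O) e)
    (h0 : e 0 = 1) : IsGoodBasis O a b e where
  isBasis := he
  zero := h0
  sq_one := by rw [h.sq_one, Algebra.algebraMap_eq_smul_one]
  sq_two := by rw [h.sq_two, Algebra.algebraMap_eq_smul_one]
  sq_three := by rw [h.sq_three, Algebra.algebraMap_eq_smul_one]
  one_two := h.one_two
  two_three := h.two_three
  three_one := h.three_one
  two_one := h.two_one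
  three_two := h.three_two
  one_three := h.one_three

theorem diagPairing_algebraMap (a b : R) (p q : Fin 3 → R) :
    diagPairing (algebraMap R K a) (algebraMap R K b) (algebraMap R K ∘ p) (algebraMap R K ∘ q) =
      algebraMap R K (diagPairing a b p q) := by
  simp [diagPairing]

theorem pureComb_crossProduct_algebraMap (g : Fin 3 → B) (p q : Fin 3 → R) :
    pureComb g (crossProduct (algebraMap R K ∘ p) (algebraMap R K ∘ q)) =
      pureComb g (crossProduct p q) := by
  simp only [pureComb, cross_apply, Function.comp_apply, Matrix.cons_val, ← map_mul, ← map_sub,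
    algebraMap_smul]

theorem isGoodTriple_daggerFamily [FaithfulSMul R K] (h2 : (2 : K) ≠ 0)
    {a b : R} (ha : a ≠ 0) (hb : b ≠ 0) {g : Fin 3 → B} (h : IsGoodTriple a b (g 0) (g 1) (g 2))
    {q : Fin 3 → Fin 3 → R}
    (hq : ∀ i j, diagPairing a b (q i) (q j) = if i = j then ![1, a, b] i else 0) :
    IsGoodTriple a b (daggerFamily a b g q 1) (daggerFamily a b g q 2)
      (daggerFamily a b g q 3) := by
  have hα : algebraMap R K a ≠ 0 := (FaithfulSMul.algebraMap_eq_zero_iff R K).not.2 ha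
  have hβ : algebraMap R K b ≠ 0 := (FaithfulSMul.algebraMap_eq_zero_iff R K).not.2 hb
  have key := isGoodTriple_of_orthogonal (h.extendScalars (K := K)) hα hβ h2
    (fun i => algebraMap R K ∘ q i) (by
      intro i j
      rw [diagPairing_algebraMap, hq]
      fin_cases i <;> fin_cases j <;> simp)
  simp only [pureComb_crossProduct_algebraMap] at key
  have := key.restrictScalars
  simpa [daggerFamily, hq] using this

theorem dagger_eq_daggerFamily [FaithfulSMul R K] (h2 : (2 : K) ≠ 0) {a b : R} (ha : a ≠ 0)
    (hb : b ≠ 0) {g : Fin 3 → B} (h : IsGoodTriple a b (g 0) (g 1) (g 2))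
    (htr : ∀ i, redTrace K (g i) = 0) {f : Fin 4 → B} {p : Fin 3 → Fin 3 → R}
    (hf : ∀ i : Fin 3, f i.succ =
      dualComb (algebraMap R K a) (algebraMap R K b) g (algebraMap R K ∘ p i)) :
    dagger K a b f = daggerFamily a b g p := by
  have hα : algebraMap R K a ≠ 0 := (FaithfulSMul.algebraMap_eq_zero_iff R K).not.2 ha
  have hβ : algebraMap R K b ≠ 0 := (FaithfulSMul.algebraMap_eq_zero_iff R K).not.2 hb
  have h4 : (4 : K) ≠ 0 := by
    rw [show (4 : K) = 2 * 2 by norm_num]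
    exact mul_ne_zero h2 h2
  have key (i j : Fin 3) : (4 * a * b) • (f i.succ * conj K (f j.succ)) =
      diagPairing a b (p i) (p j) • (1 : B) + pureComb g (crossProduct (p i) (p j)) := by
    rw [hf, hf, dualComb_mul_conj h.extendScalars hα hβ h2 htr, diagPairing_algebraMap,
      pureComb_crossProduct_algebraMap, algebraMap_smul, ← algebraMap_smul K (4 * a * b),
      smul_smul]
    simp only [map_mul, map_ofNat]
    rw [mul_inv_cancel₀ (mul_ne_zero (mul_ne_zero h4 hα) hβ), one_smul]
  ext i
  fin_cases i
  exacts [rfl, key 1 2, key 2 0, key 0 1]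

/-- The factor is `2ab` rather than `4ab` because the reduced trace doubles scalars. -/
theorem gramMatrix_eq [FaithfulSMul R K] (h2 : (2 : K) ≠ 0) {a b : R} (ha : a ≠ 0)
    (hb : b ≠ 0) {g : Fin 3 → B} (h : IsGoodTriple a b (g 0) (g 1) (g 2))
    (htr1 : redTrace K (1 : B) = 2)
    (htr : ∀ i, redTrace K (g i) = 0) {f : Fin 4 → B} {p : Fin 3 → Fin 3 → R}
    (hf : ∀ i : Fin 3, f i.succ =
      dualComb (algebraMap R K a) (algebraMap R K b) g (algebraMap R K ∘ p i)) :
    (2 * algebraMap R K a * algebraMap R K b) • gramMatrix K f =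
      (algebraMap R K).mapMatrix (Matrix.of fun i j => diagPairing a b (p i) (p j)) := by
  have hα : algebraMap R K a ≠ 0 := (FaithfulSMul.algebraMap_eq_zero_iff R K).not.2 ha
  have hβ : algebraMap R K b ≠ 0 := (FaithfulSMul.algebraMap_eq_zero_iff R K).not.2 hb
  ext i j
  simp only [gramMatrix, Matrix.smul_apply, Matrix.of_apply, RingHom.mapMatrix_apply,
    Matrix.map_apply, smul_eq_mul]
  rw [hf, hf, dualComb_mul_conj h.extendScalars hα hβ h2 htr, diagPairing_algebraMap, map_smul,
    redTrace_comb htr1 htr, smul_eq_mul, show (4 : K) = 2 * 2 by norm_num]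
  field_simp

/-- The coordinates are the traces `-Tr(x g i)`, which lie in `R` by definition of the dual lattice.
-/
theorem exists_dualComb_of_mem_dualLattice [FaithfulSMul R K] (h2 : (2 : K) ≠ 0) {a b : R}
    (ha : a ≠ 0) (hb : b ≠ 0) {g : Fin 3 → B} (h : IsGoodTriple a b (g 0) (g 1) (g 2))
    (bas : Module.Basis (Fin 4) K B) (hbas : ⇑bas = ![1, g 0, g 1, g 2])
    (htr1 : redTrace K (1 : B) = 2) (htr : ∀ i, redTrace K (g i) = 0) {Λ : Submodule R B}
    (hΛ : ∀ i, g i ∈ Λ) {x : B} (hx : x ∈ dualLattice K Λ) (hx0 : redTrace K x = 0) :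
    ∃ p : Fin 3 → R, x = dualComb (algebraMap R K a) (algebraMap R K b) g (algebraMap R K ∘ p) := by
  have hα : algebraMap R K a ≠ 0 := (FaithfulSMul.algebraMap_eq_zero_iff R K).not.2 ha
  have hβ : algebraMap R K b ≠ 0 := (FaithfulSMul.algebraMap_eq_zero_iff R K).not.2 hb
  have hint (i) : ∃ r : R, algebraMap R K r = redTrace K (x * g i) :=
    Submodule.mem_one.1 ((LinearMap.BilinForm.mem_dualSubmodule _).1 hx _ (hΛ i))
  choose r hr using hint
  refine ⟨fun i => -r i, ?_⟩
  rw [exists_eq_dualComb h.extendScalars hα hβ h2 bas hbas htr1 htr hx0]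
  congr 1
  ext i
  simp [hr]

/-- As `n = 2v(a) + 1`, the ideal `𝔭ⁿ` equals `a² 𝔭`; the extra `1` leaves a factor in `𝔭`. -/
theorem exists_eq_sq_mul_of_mem_pow [IsDomain R] [IsDiscreteValuationRing R] {a : R}
    (ha : a ≠ 0) {n : ℕ} (hn : (n : ℕ∞) = 2 * IsDiscreteValuationRing.addVal R a + 1) {c : R}
    (hc : c ∈ IsLocalRing.maximalIdeal R ^ n) :
    ∃ y ∈ IsLocalRing.maximalIdeal R, c = a ^ 2 * y := by
  obtain ⟨ϖ, hϖ⟩ := IsDiscreteValuationRing.exists_irreducible R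
  obtain ⟨k, v, rfl⟩ := IsDiscreteValuationRing.eq_unit_mul_pow_irreducible ha hϖ
  rw [IsDiscreteValuationRing.addVal_def _ v hϖ k rfl] at hn
  obtain rfl : n = 2 * k + 1 := by exact_mod_cast hn
  rw [hϖ.maximalIdeal_eq, Ideal.span_singleton_pow, Ideal.mem_span_singleton] at hc
  obtain ⟨z, rfl⟩ := hc
  refine ⟨ϖ * ((↑v⁻¹ : R) ^ 2 * z), ?_, ?_⟩
  · rw [hϖ.maximalIdeal_eq, Ideal.mem_span_singleton]
    exact dvd_mul_right _ _
  · have hv : (v : R) * ↑v⁻¹ = 1 := v.mul_inv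
    linear_combination (-(ϖ ^ (2 * k + 1) * z) * ((v : R) * ↑v⁻¹ + 1)) * hv

end Orders
end QuatOrder

end

/-! ### The main theorem. -/

theorem mainTheorem4
    {R K B : Type*}
    -- `R` is a complete discrete valuation ring in which `2` is a unit, `K` its fraction field
    [CommRing R] [IsDomain R] [IsDiscreteValuationRing R]
    [IsAdicComplete (IsLocalRing.maximalIdeal R) R]
    [Field K] [Algebra R K] [IsFractionRing R K]
    (h2 : IsUnit (2 : R))
    -- `B` is a quaternion algebra over `K`
    [Ring B] [Algebra K B] [Algebra R B] [IsScalarTower R K B]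
    [Algebra.IsCentral K B] [IsSimpleRing B] (hB : Module.finrank K B = 4)
    -- `O` is an order of `B` in correspondence with the form `⟨1, a, b⟩`
    (O : Subalgebra R B) (hO : QuatOrder.IsOrder K O)
    (a b : R) (ha : a ≠ 0) (hb : b ≠ 0)
    (hf : QuatOrder.Corresponds O a b)
    -- `{f 0, f 1, f 2, f 3}` is a basis of the dual lattice with the trace normalization
    (f : Fin 4 → B)
    (hbasis : QuatOrder.IsBasisOf
      (QuatOrder.dualLattice K (Subalgebra.toSubmodule O)) f)
    (htr0 : QuatOrder.redTrace K (f 0) = 1)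
    (htr : ∀ i : Fin 3, QuatOrder.redTrace K (f i.succ) = 0)
    -- `n = 2 v(a) + 1`
    (n : ℕ) (hn : (n : ℕ∞) = 2 * IsDiscreteValuationRing.addVal R a + 1)
    (hcongr : ∃ b' : R, QuatOrder.MatrixCongr K (IsLocalRing.maximalIdeal R ^ n)
      ((2 * algebraMap R K a * algebraMap R K b) • QuatOrder.gramMatrix K f)
      (Matrix.diagonal ![1, algebraMap R K a, algebraMap R K b']))
    -- `det M = 8⁻¹ (ab)⁻² u²` with `u² ≡ 1` modulo the maximal ideal (in particular `u = 1`)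
    (u : R) (hu : u ^ 2 - 1 ∈ IsLocalRing.maximalIdeal R)
    (hdet : (QuatOrder.gramMatrix K f).det =
      (8 : K)⁻¹ * ((algebraMap R K a * algebraMap R K b) ^ 2)⁻¹ * algebraMap R K u ^ 2) :
    QuatOrder.IsQuasiGoodBasis O a b (QuatOrder.dagger K a b f) := by
  have hinj : FaithfulSMul R K := inferInstance
  have h2K : (2 : K) ≠ 0 := by
    rw [← map_ofNat (algebraMap R K) 2]
    exact (h2.map (algebraMap R K)).ne_zero
  have hα : algebraMap R K a ≠ 0 := (FaithfulSMul.algebraMap_eq_zero_iff R K).not.2 ha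
  have hβ : algebraMap R K b ≠ 0 := (FaithfulSMul.algebraMap_eq_zero_iff R K).not.2 hb
  obtain ⟨g, hg, hspan⟩ := hf.exists_isGoodTriple
  have hspanK : ⊤ ≤ Submodule.span K (Set.range ![1, g 0, g 1, g 2]) :=
    (QuatOrder.span_field_eq_top hO hspan).ge
  have hcard : Fintype.card (Fin 4) = Module.finrank K B := by simp [hB]
  -- Four elements spanning a space of dimension four are independent over `K`, hence over `R`.
  have hli : LinearIndependent K ![1, g 0, g 1, g 2] :=
    linearIndependent_of_top_le_span_of_card_eq_finrank hspanK hcard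
  have hgO : QuatOrder.IsBasisOf (Subalgebra.toSubmodule O) ![1, g 0, g 1, g 2] :=
    ⟨(LinearIndependent.iff_fractionRing R K).2 hli, hspan⟩
  let bas : Module.Basis (Fin 4) K B := .mk hli hspanK
  have hbas : ⇑bas = ![1, g 0, g 1, g 2] := Module.Basis.coe_mk hli hspanK
  have htr1 : QuatOrder.redTrace K (1 : B) = 2 := QuatOrder.redTrace_one h2K hB
  have htrg := hg.extendScalars.redTrace_eq_zero (K := K) bas hbas
  have hgmem (i) : g i ∈ Subalgebra.toSubmodule O := by
    have h (j) : ![1, g 0, g 1, g 2] j ∈ Subalgebra.toSubmodule O :=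
      hspan ▸ Submodule.subset_span ⟨j, rfl⟩
    fin_cases i
    exacts [h 1, h 2, h 3]
  have hfmem (i : Fin 3) :
      f i.succ ∈ QuatOrder.dualLattice K (Subalgebra.toSubmodule O) :=
    hbasis.2 ▸ Submodule.subset_span ⟨_, rfl⟩
  choose p hp using fun i => QuatOrder.exists_dualComb_of_mem_dualLattice h2K ha hb hg bas hbas
    htr1 htrg hgmem (hfmem i) (htr i)
  have hgram := QuatOrder.gramMatrix_eq h2K ha hb hg htr1 htrg hp
  -- Taking determinants in `hgram`, the left side is `(2ab)³ · 8⁻¹ (ab)⁻² u² = ab u²` and the right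
  -- side is `det(p)² ab`.
  have hpdet : (Matrix.of p).det ^ 2 = u ^ 2 := by
    have h8 : (8 : K) ≠ 0 := by
      rw [show (8 : K) = 2 ^ 3 by norm_num]
      exact pow_ne_zero 3 h2K
    have h := congrArg Matrix.det hgram
    rw [Matrix.det_smul, hdet, ← RingHom.map_det, ← QuatOrder.det_sq_mul_eq_gram,
      Fintype.card_fin] at h
    apply FaithfulSMul.algebraMap_injective R K
    apply mul_right_cancel₀ (mul_ne_zero hα hβ)
    rw [← map_mul (algebraMap R K) a b, ← map_mul, ← h]
    simp only [map_mul, map_pow]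
    field_simp
    norm_num
  have hpu : IsUnit ((Matrix.of p).det ^ 2) := by
    rw [hpdet]
    obtain ⟨t, ht, -⟩ := QuatOrder.exists_mul_eq_one_of_sub_one_mem hu
    exact .of_mul_eq_one_right t ht
  obtain ⟨b', hcongr⟩ := hcongr
  rw [hgram] at hcongr
  have happrox (i j) : ∃ y ∈ IsLocalRing.maximalIdeal R,
      QuatOrder.diagPairing a b (p i) (p j) =
        Matrix.diagonal ![1, a, b'] i j + a ^ 2 * y := by
    obtain ⟨c, hc, hcij⟩ := hcongr i j
    obtain ⟨y, hy, rfl⟩ := QuatOrder.exists_eq_sq_mul_of_mem_pow ha hn hc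
    refine ⟨y, hy, FaithfulSMul.algebraMap_injective R K ?_⟩
    have hd : Matrix.diagonal ![1, algebraMap R K a, algebraMap R K b'] i j =
        algebraMap R K (Matrix.diagonal ![1, a, b'] i j) := by
      fin_cases i <;> fin_cases j <;> simp
    rw [map_add, ← hcij, ← hd]
    simp
  obtain ⟨q, hqp, hq⟩ := QuatOrder.exists_orthogonal_congr h2 ha p
    (by simpa using happrox 0 0) (by simpa using happrox 0 1) (by simpa using happrox 0 2)
    (by simpa using happrox 1 2) (by simpa using happrox 1 1) (by rwa [hpdet])
  have hqu : IsUnit ((Matrix.of q).det ^ 2) := by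
    have h := QuatOrder.det_sq_mul_eq_gram a b q
    simp only [hq] at h
    have : (Matrix.of q).det ^ 2 = 1 := by
      apply mul_right_cancel₀ (mul_ne_zero ha hb)
      rw [h]
      simp [Matrix.det_fin_three]
    rw [this]
    exact isUnit_one
  rw [QuatOrder.dagger_eq_daggerFamily h2K ha hb hg htrg hp]
  exact ⟨QuatOrder.isBasisOf_daggerFamily hgO hpu, rfl, QuatOrder.daggerFamily a b g q,
    (QuatOrder.isGoodTriple_daggerFamily h2K ha hb hg hq).isGoodBasis
      (QuatOrder.isBasisOf_daggerFamily hgO hqu) rfl,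
    QuatOrder.daggerFamily_sub_mem hgO hqp⟩
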